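/- A \emph{unit interval order} is a poset $(U,\succ)$ that is isomorphic to a finite set of real numbers with the order $u\succ w \iff u\ge w+1$. Its \emph{incomparability graph} $\mathrm{inc}(U)$ has the elements of $U$ as vertices, two of them being adjacent if and only if they are not comparable in $U$. For a finite graph $G$ with vertex set $V(G)=\{v_1,\dots,v_n\}$, regard the vertices as commuting variables and define in $\mathbb{R}[v_1,\dots,v_n]$ the elementary $G$-symmetric polynomials $$e_i^G=\sum_{\substack{S\subseteq V(G)\ \text{stable}\\ \#S=i}}\ \prod_{v\in S}v\quad (i\ge 0),\qquad e_i^G=0\quad (i<0),$$ where a set of vertices is stable if no two of its elements are adjacent; in particular $e_0^G=1$. For a partition $\lambda$ with conjugate partition $\lambda^*=(\lambda^*_1\ge\dots\ge\lambda^*_m>0)$, the $G$-Schur polynomial is $$s_\lambda^G=\det\bigl(e^G_{\lambda_i^*+j-i}\bigr)_{1\le i,j\le m}.$$ \textbf{Theorem.} Let $U$ be a unit interval order and $G=\mathrm{inc}(U)$ its incomparability graph. Then for every partition $\lambda$ one has $s_\lambda^G\in\mathbb{N}[V(G)]$; that is, all coefficients of the polynomial $s_\lambda^G$ are nonnegative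 integers. -/

import Mathlib

/-- A unit interval order: a finite poset isomorphic to a (finite) set of real numbers ordered by
`u ≺ w` if and only if `u + 1 ≤ w`.  The map `f` is the isomorphism onto its image. -/
def IsUnitIntervalOrder (U : Type*) [PartialOrder U] : Prop :=
  Finite U ∧ ∃ f : U → ℝ, Function.Injective f ∧ ∀ u w : U, u < w ↔ f u + 1 ≤ f w

/-- The incomparability graph of a poset: the vertices are the elements, and two of them are
adjacent exactly when they are not comparable. -/
def incGraph (P : Type*) [PartialOrder P] : SimpleGraph P where
  Adj u v := IncompRel (· ≤ ·) u v
  symm := ⟨fun _ _ h => ⟨h.2, h.1⟩⟩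
  loopless := ⟨fun _ h => h.1 le_rfl⟩

open Classical in
/-- The elementary `G`-symmetric polynomial `e_i^G` in commuting variables indexed by the vertices:
for `i ≥ 0` the sum over the stable sets `S` with `i` elements of the product of the vertices
in `S` (so `e_0^G = 1`), and `0` for `i < 0`. -/
noncomputable def elemGPoly {V : Type*} [Fintype V] (G : SimpleGraph V) (i : ℤ) :
    MvPolynomial V ℝ :=
  if i < 0 then 0
  else ∑ S : Finset V with G.IsNIndepSet i.toNat S, ∏ v ∈ S, MvPolynomial.X v

/-- The `G`-Schur polynomial `s_λ^G = det (e^G_{λ*_i + j - i})_{i,j}`, where `λ*` is the conjugate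
of the partition `λ` and the matrix has as many rows as `λ*` has parts.  Partitions are given by
their Young diagrams: `lam.rowLen i` is the part of `lam` with index `i` (counted from `0`),
`lam.transpose` is the conjugate partition, and `lam.rowLens.length` is the number of parts. -/
noncomputable def schurGPoly {V : Type*} [Fintype V] (G : SimpleGraph V) (lam : YoungDiagram) :
    MvPolynomial V ℝ :=
  Matrix.det (Matrix.of fun i j : Fin lam.transpose.rowLens.length =>
    elemGPoly G ((lam.transpose.rowLen i : ℤ) + (j : ℤ) - (i : ℤ)))

/-! Stable sets of the incomparability graph are chains, so the Leibniz formula turns the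
determinant into a signed sum over pairs of a permutation `σ` and an array of chains, row `i` having
length `k (σ i) + i`. A sign-reversing involution in the style of Gasharov cancels every array
violating the tableau condition: at a canonically chosen flaw the tails of two adjacent rows are
exchanged and `σ` is multiplied by a transposition (`IsLeadingFlaw.pairwise_swapTails`,
`IsLeadingFlaw.isLeadingFlaw_swapTails`). The unit interval hypothesis is what keeps the new rows
chains. A flawless array has weakly decreasing row lengths, which forces `σ = 1`
(`perm_eq_one_of_not_isFlaw`), so the surviving terms are monomials with sign `+1`. -/

open Classical in
/-- The strictly increasing lists in `P` of length `k`. -/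
noncomputable def chainLists (P : Type*) [PartialOrder P] [Fintype P] (k : ℤ) :
    Finset (List P) :=
  ((Finset.univ : Finset {l : List P // l.Nodup}).map ⟨Subtype.val, Subtype.val_injective⟩).filter
    fun l => l.Pairwise (· < ·) ∧ (l.length : ℤ) = k

theorem mem_chainLists {P : Type*} [PartialOrder P] [Fintype P] {k : ℤ} {l : List P} :
    l ∈ chainLists P k ↔ l.Pairwise (· < ·) ∧ (l.length : ℤ) = k := by
  classical
  simp only [chainLists, Finset.mem_filter, Finset.mem_map, Finset.mem_univ, true_and,
    Function.Embedding.coeFn_mk, Subtype.exists, exists_prop, exists_eq_right,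
    and_iff_right_iff_imp]
  exact fun h => h.1.imp ne_of_lt

/-- The monomial of a list of variables. -/
noncomputable def listMonomial {V : Type*} (l : List V) : MvPolynomial V ℝ :=
  (l.map MvPolynomial.X).prod

theorem listMonomial_append {V : Type*} (l l' : List V) :
    listMonomial (l ++ l') = listMonomial l * listMonomial l' := by
  simp [listMonomial]

theorem listMonomial_mem_rangeS {V : Type*} (l : List V) :
    listMonomial l ∈ (MvPolynomial.map (σ := V) (Nat.castRingHom ℝ)).rangeS := by
  refine Subsemiring.list_prod_mem _ fun x hx => ?_
  obtain ⟨v, -, rfl⟩ := List.mem_map.1 hx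
  exact ⟨MvPolynomial.X v, by simp⟩

theorem isIndepSet_incGraph_iff {P : Type*} [PartialOrder P] {S : Set P} :
    (incGraph P).IsIndepSet S ↔ IsChain (· ≤ ·) S := by
  refine forall₂_congr fun a _ => forall₂_congr fun b _ => forall_congr' fun _ => ?_
  simp only [incGraph, IncompRel]
  tauto

/-- A finite chain can be listed in strictly increasing order. -/
theorem exists_pairwise_lt_toFinset_eq {P : Type*} [PartialOrder P] [DecidableEq P]
    (S : Finset P) (hS : IsChain (· ≤ ·) (S : Set P)) :
    ∃ l : List P, l.Pairwise (· < ·) ∧ l.toFinset = S := by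
  induction hn : S.card generalizing S with
  | zero => exact ⟨[], List.Pairwise.nil, by simpa using (Finset.card_eq_zero.1 hn).symm⟩
  | succ n ih =>
    obtain ⟨a, ha⟩ := S.exists_minimal (Finset.card_pos.1 (by omega))
    obtain ⟨l, hl, hlS⟩ := ih (S.erase a)
      (hS.mono (by simp)) (by rw [Finset.card_erase_of_mem ha.1]; omega)
    refine ⟨a :: l, List.pairwise_cons.2 ⟨fun b hb => ?_, hl⟩, ?_⟩
    · have hb' : b ∈ S.erase a := hlS ▸ List.mem_toFinset.2 hb
      obtain ⟨hne, hbS⟩ := Finset.mem_erase.1 hb'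
      rcases hS ha.1 hbS hne.symm with h | h
      · exact lt_of_le_of_ne h hne.symm
      · exact lt_of_le_of_ne (ha.2 hbS h) hne.symm
    · rw [List.toFinset_cons, hlS, Finset.insert_erase ha.1]

/-- The elementary polynomial of an incomparability graph is the generating function of the
strictly increasing lists. -/
theorem elemGPoly_incGraph {P : Type*} [PartialOrder P] [Fintype P] (k : ℤ) :
    elemGPoly (incGraph P) k = ∑ l ∈ chainLists P k, listMonomial l := by
  classical
  unfold elemGPoly
  split_ifs with hk
  · symm
    refine Finset.sum_eq_zero fun l hl => ?_
    have := (mem_chainLists.1 hl).2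
    omega
  · symm
    refine Finset.sum_bij (fun l _ => l.toFinset) ?_ ?_ ?_ ?_
    · intro l hl
      obtain ⟨h, hlen⟩ := mem_chainLists.1 hl
      have hc : IsChain (· ≤ ·) {x | x ∈ l} := by
        intro a ha b hb hab
        obtain ⟨i, hi, rfl⟩ := List.getElem_of_mem ha
        obtain ⟨j, hj, rfl⟩ := List.getElem_of_mem hb
        rcases lt_trichotomy i j with hij | rfl | hij
        · exact Or.inl (List.pairwise_iff_getElem.1 h i j hi hj hij).le
        · exact absurd rfl hab
        · exact Or.inr (List.pairwise_iff_getElem.1 h j i hj hi hij).le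
      rw [Finset.mem_filter, SimpleGraph.isNIndepSet_iff, isIndepSet_incGraph_iff,
        List.toFinset_card_of_nodup (h.imp ne_of_lt)]
      refine ⟨Finset.mem_univ _, ?_, by omega⟩
      simpa using hc
    · intro l hl l' hl' h
      obtain ⟨hl, -⟩ := mem_chainLists.1 hl
      obtain ⟨hl', -⟩ := mem_chainLists.1 hl'
      exact ((List.perm_of_nodup_nodup_toFinset_eq (hl.imp ne_of_lt) (hl'.imp ne_of_lt)
        h)).eq_of_pairwise (fun a b _ _ h h' => absurd h' h.asymm) hl hl'
    · intro S hS
      rw [Finset.mem_filter, SimpleGraph.isNIndepSet_iff, isIndepSet_incGraph_iff] at hS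
      obtain ⟨l, hl, rfl⟩ := exists_pairwise_lt_toFinset_eq S hS.2.1
      rw [List.toFinset_card_of_nodup (hl.imp ne_of_lt)] at hS
      exact ⟨l, mem_chainLists.2 ⟨hl, by omega⟩, rfl⟩
    · intro l hl
      rw [List.prod_toFinset _ ((mem_chainLists.1 hl).1.imp ne_of_lt), listMonomial]

/-! ### Flaws of arrays and the choice of a canonical one -/

/-- The rows `r` and `s = r + 1` of the array `A` violate the tableau condition in column `c`:
row `s` has an entry there, and row `r` has no entry or a larger one. -/
def IsFlaw {P : Type*} [PartialOrder P] {m : ℕ} (A : Fin m → List P) (r s : Fin m) (c : ℕ) :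
    Prop :=
  s.val = r.val + 1 ∧ ∃ x, (A s)[c]? = some x ∧ ∀ y, (A r)[c]? = some y → x < y

/-- A flaw in the first possible column and, within it, in the last possible row. -/
structure IsLeadingFlaw {P : Type*} [PartialOrder P] {m : ℕ} (A : Fin m → List P) (r s : Fin m)
    (c : ℕ) : Prop where
  isFlaw : IsFlaw A r s c
  le_col : ∀ r' s' c', IsFlaw A r' s' c' → c ≤ c'
  row_le : ∀ r' s', IsFlaw A r' s' c → r' ≤ r

theorem exists_isLeadingFlaw {P : Type*} [PartialOrder P] {m : ℕ} {A : Fin m → List P}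
    (h : ∃ r s c, IsFlaw A r s c) : ∃ r s c, IsLeadingFlaw A r s c := by
  classical
  have hc : ∃ c r s, IsFlaw A r s c := by
    obtain ⟨r, s, c, h⟩ := h
    exact ⟨c, r, s, h⟩
  have hne : (Finset.univ.filter fun r => ∃ s, IsFlaw A r s (Nat.find hc)).Nonempty := by
    obtain ⟨r, h⟩ := Nat.find_spec hc
    exact ⟨r, by simpa using h⟩
  obtain ⟨r, hr⟩ := Finset.exists_maximal hne
  obtain ⟨s, hs⟩ := (Finset.mem_filter.1 hr.1).2
  refine ⟨r, s, Nat.find hc, hs, fun r' s' c' h => Nat.find_min' hc ⟨r', s', h⟩,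
    fun r' s' h => ?_⟩
  exact (le_total r' r).elim id fun hle => hr.2 (by simpa using ⟨s', h⟩) hle

theorem IsLeadingFlaw.unique {P : Type*} [PartialOrder P] {m : ℕ} {A : Fin m → List P}
    {r s r' s' : Fin m} {c c' : ℕ} (h : IsLeadingFlaw A r s c) (h' : IsLeadingFlaw A r' s' c') :
    r = r' ∧ s = s' ∧ c = c' := by
  obtain rfl : c = c' := le_antisymm (h.le_col _ _ _ h'.isFlaw) (h'.le_col _ _ _ h.isFlaw)
  obtain rfl : r = r' := le_antisymm (h'.row_le _ _ h.isFlaw) (h.row_le _ _ h'.isFlaw)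
  exact ⟨rfl, Fin.ext (h.isFlaw.1.trans h'.isFlaw.1.symm), rfl⟩

/-! ### The tail exchange -/

/-- Exchange the tails of the rows `r` and `s` of an array, the one of row `r` starting in column
`c` and the one of row `s` starting in column `c + 1`. -/
def swapTails {P : Type*} {m : ℕ} (A : Fin m → List P) (r s : Fin m) (c : ℕ) : Fin m → List P :=
  fun i =>
    if i = r then (A r).take c ++ (A s).drop (c + 1)
    else if i = s then (A s).take (c + 1) ++ (A r).drop c
    else A i

theorem IsFlaw.ne {P : Type*} [PartialOrder P] {m : ℕ} {A : Fin m → List P} {r s : Fin m} {c : ℕ}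
    (h : IsFlaw A r s c) : s ≠ r := by
  have := h.1
  rintro rfl
  omega

theorem IsFlaw.lt_length {P : Type*} [PartialOrder P] {m : ℕ} {A : Fin m → List P} {r s : Fin m}
    {c : ℕ} (h : IsFlaw A r s c) : c < (A s).length := by
  obtain ⟨-, x, hx, -⟩ := h
  exact (List.getElem?_eq_some_iff.1 hx).1

/-- If row `r` ended before column `c`, its first missing column would already be a flaw,
contradicting the minimality of `c`. -/
theorem IsLeadingFlaw.le_length {P : Type*} [PartialOrder P] {m : ℕ} {A : Fin m → List P}
    {r s : Fin m} {c : ℕ} (h : IsLeadingFlaw A r s c) : c ≤ (A r).length := by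
  by_contra! hlt
  have hs := h.isFlaw.lt_length
  have hflaw : IsFlaw A r s (A r).length :=
    ⟨h.isFlaw.1, (A s)[(A r).length], List.getElem?_eq_getElem (by omega), by simp⟩
  have := h.le_col _ _ _ hflaw
  omega

theorem swapTails_left {P : Type*} {m : ℕ} (A : Fin m → List P) (r s : Fin m) (c : ℕ) :
    swapTails A r s c r = (A r).take c ++ (A s).drop (c + 1) := by
  simp [swapTails]

theorem swapTails_right {P : Type*} {m : ℕ} (A : Fin m → List P) {r s : Fin m} (hrs : s ≠ r)
    (c : ℕ) : swapTails A r s c s = (A s).take (c + 1) ++ (A r).drop c := by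
  simp [swapTails, hrs]

theorem swapTails_of_ne {P : Type*} {m : ℕ} (A : Fin m → List P) {r s i : Fin m} (hr : i ≠ r)
    (hs : i ≠ s) (c : ℕ) : swapTails A r s c i = A i := by
  simp [swapTails, hr, hs]

/-- Both rows reach their cut, so the kept prefixes have lengths exactly `c` and `c + 1`, and
cutting again at the same places recovers the original tails. -/
theorem IsLeadingFlaw.swapTails_swapTails {P : Type*} [PartialOrder P] {m : ℕ}
    {A : Fin m → List P} {r s : Fin m} {c : ℕ} (h : IsLeadingFlaw A r s c) :
    swapTails (swapTails A r s c) r s c = A := by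
  have hne := h.isFlaw.ne
  have hs := h.isFlaw.lt_length
  have hr := h.le_length
  funext i
  by_cases hir : i = r
  · subst hir
    rw [swapTails_left, swapTails_left, swapTails_right A hne,
      List.take_left' (by simpa using hr), List.drop_left' (by simpa using hs),
      List.take_append_drop]
  by_cases his : i = s
  · subst his
    rw [swapTails_right _ hne, swapTails_left, swapTails_right A hne,
      List.take_left' (by simpa using hs), List.drop_left' (by simpa using hr),
      List.take_append_drop]
  rw [swapTails_of_ne _ hir his, swapTails_of_ne _ hir his]

theorem IsLeadingFlaw.getElem?_swapTails {P : Type*} [PartialOrder P] {m : ℕ}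
    {A : Fin m → List P} {r s : Fin m} {c : ℕ} (h : IsLeadingFlaw A r s c) {i : Fin m} {d : ℕ}
    (hd : d < c ∨ d = c ∧ i ≠ r) : (swapTails A r s c i)[d]? = (A i)[d]? := by
  have hne := h.isFlaw.ne
  have hs := h.isFlaw.lt_length
  have hr := h.le_length
  by_cases hir : i = r
  · subst hir
    have hd : d < c := by tauto
    rw [swapTails_left, List.getElem?_append_left (by simp; omega), List.getElem?_take_of_lt hd]
  by_cases his : i = s
  · subst his
    rw [swapTails_right _ hne, List.getElem?_append_left (by simp; omega),
      List.getElem?_take_of_lt (by omega)]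
  rw [swapTails_of_ne _ hir his]

theorem isFlaw_congr {P : Type*} [PartialOrder P] {m : ℕ} {A B : Fin m → List P} {r s : Fin m}
    {c : ℕ} (hr : (A r)[c]? = (B r)[c]?) (hs : (A s)[c]? = (B s)[c]?) :
    IsFlaw A r s c ↔ IsFlaw B r s c := by
  rw [IsFlaw, IsFlaw, hr, hs]

/-- Up to column `c` the exchange alters only the entry of row `r` in column `c`. Hence no flaw
appears in an earlier column, nor in column `c` at a row after `r`; this is why the last row is
chosen. -/
theorem IsLeadingFlaw.isLeadingFlaw_swapTails {P : Type*} [PartialOrder P] {m : ℕ}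
    {A : Fin m → List P} {r s : Fin m} {c : ℕ} (h : IsLeadingFlaw A r s c)
    (hA : (A s).Pairwise (· < ·)) : IsLeadingFlaw (swapTails A r s c) r s c := by
  have hne := h.isFlaw.ne
  have hs := h.isFlaw.lt_length
  have hr := h.le_length
  refine ⟨⟨h.isFlaw.1, (A s)[c], ?_, fun y hy => ?_⟩, fun r' s' c' h' => ?_, fun r' s' h' => ?_⟩
  · rw [h.getElem?_swapTails (Or.inr ⟨rfl, hne⟩), List.getElem?_eq_getElem hs]
  -- The new entry of row `r` in column `c`, if any, is `(A s)[c + 1]`, which exceeds `(A s)[c]`.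
  · rw [swapTails_left, List.getElem?_append_right (by simp), List.getElem?_drop,
      List.length_take, min_eq_left hr, Nat.sub_self, add_zero] at hy
    obtain ⟨hlt, rfl⟩ := List.getElem?_eq_some_iff.1 hy
    exact List.pairwise_iff_getElem.1 hA _ _ _ _ (Nat.lt_succ_self c)
  · by_contra! hlt
    rw [isFlaw_congr (h.getElem?_swapTails (Or.inl hlt)) (h.getElem?_swapTails (Or.inl hlt))] at h'
    exact absurd (h.le_col _ _ _ h') (by omega)
  · by_contra! hlt
    have := h'.1
    rw [isFlaw_congr (h.getElem?_swapTails (Or.inr ⟨rfl, hlt.ne'⟩))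
      (h.getElem?_swapTails (Or.inr ⟨rfl, fun h => by omega⟩))] at h'
    exact absurd (h.row_le _ _ h') (by omega)

theorem IsLeadingFlaw.prod_swapTails {P : Type*} [PartialOrder P] {m : ℕ}
    {A : Fin m → List P} {r s : Fin m} {c : ℕ} (h : IsLeadingFlaw A r s c) :
    ∏ i, listMonomial (swapTails A r s c i) = ∏ i, listMonomial (A i) := by
  have hne := h.isFlaw.ne
  have hsr : s ∈ Finset.univ.erase r := by simp [hne]
  rw [← Finset.mul_prod_erase _ _ (Finset.mem_univ r), ← Finset.mul_prod_erase _ _ hsr,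
    ← Finset.mul_prod_erase Finset.univ (fun i => listMonomial (A i)) (Finset.mem_univ r),
    ← Finset.mul_prod_erase _ (fun i => listMonomial (A i)) hsr,
    swapTails_left, swapTails_right _ hne, ← mul_assoc, ← mul_assoc]
  congr 1
  · have hr := congrArg listMonomial (List.take_append_drop c (A r))
    have hs := congrArg listMonomial (List.take_append_drop (c + 1) (A s))
    rw [listMonomial_append] at hr hs
    rw [← hr, ← hs, listMonomial_append, listMonomial_append]
    ring
  · refine Finset.prod_congr rfl fun i hi => ?_
    simp only [Finset.mem_erase] at hi
    rw [swapTails_of_ne _ hi.2.1 hi.1]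

/-- In a unit interval order the tails at the leading flaw of an array of strictly increasing rows
can be exchanged. -/
theorem IsLeadingFlaw.pairwise_swapTails {P : Type*} [PartialOrder P] {f : P → ℝ}
    (hf : ∀ u w : P, u < w ↔ f u + 1 ≤ f w) {m : ℕ}
    {A : Fin m → List P} {r s : Fin m} {c : ℕ} (h : IsLeadingFlaw A r s c)
    (hA : ∀ i, (A i).Pairwise (· < ·)) (i : Fin m) :
    (swapTails A r s c i).Pairwise (· < ·) := by
  have hne := h.isFlaw.ne
  have hs := h.isFlaw.lt_length
  have hr := h.le_length
  have mono : ∀ (j : Fin m) {a b : ℕ} (hb : b < (A j).length) (hab : a < b),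
      (A j)[a] < (A j)[b] :=
    fun j a b hb hab => List.pairwise_iff_getElem.1 (hA j) a b _ hb hab
  have mono' : ∀ (j : Fin m) {a b : ℕ} (hb : b < (A j).length) (hab : a ≤ b),
      (A j)[a] ≤ (A j)[b] := fun j a b hb hab => by
    rcases hab.eq_or_lt with rfl | hab
    exacts [le_rfl, (mono j hb hab).le]
  by_cases hir : i = r
  · subst hir
    rw [swapTails_left, List.pairwise_append]
    refine ⟨(hA _).take, (hA _).drop, fun x hx y hy => ?_⟩
    obtain ⟨a, ha, rfl⟩ := List.mem_take_iff_getElem.1 hx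
    obtain ⟨b, hb, rfl⟩ := List.mem_drop_iff_getElem.1 hy
    -- The prefix of length `c` contains `x`, so there is a column `d` just before the flaw, itself
    -- without flaws.
    obtain ⟨d, rfl⟩ : ∃ d, c = d + 1 := ⟨c - 1, by omega⟩
    have hflaw : ¬ (A s)[d] < (A i)[d] := fun hlt => by
      have := h.le_col i s d ⟨h.isFlaw.1, (A s)[d], List.getElem?_eq_getElem (by omega),
        fun y hy => by
          obtain ⟨_, rfl⟩ := List.getElem?_eq_some_iff.1 hy
          exact hlt⟩
      omega
    refine (mono' i (b := d) (by omega) (by omega)).trans_lt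
      (lt_of_lt_of_le ?_ (mono' s (a := d + 2) (by omega) (by omega)))
    -- Two steps in row `s` raise `f` by at least 2, while the absence of a flaw puts `(A i)[d]`
    -- less than 1 above `(A s)[d]`; a gap of more than 1 remains.
    have h1 := (hf _ _).1 (mono s (a := d) (b := d + 1) (by omega) (by omega))
    have h2 := (hf _ _).1 (mono s (a := d + 1) (b := d + 2) (by omega) (by omega))
    rw [hf, not_le] at hflaw
    rw [hf]
    linarith
  by_cases his : i = s
  · subst his
    rw [swapTails_right _ hne, List.pairwise_append]
    refine ⟨(hA _).take, (hA _).drop, fun x hx y hy => ?_⟩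
    obtain ⟨a, ha, rfl⟩ := List.mem_take_iff_getElem.1 hx
    obtain ⟨b, hb, rfl⟩ := List.mem_drop_iff_getElem.1 hy
    obtain ⟨-, x, hx, hxy⟩ := h.isFlaw
    obtain ⟨_, rfl⟩ := List.getElem?_eq_some_iff.1 hx
    have hc := hxy (A r)[c] (List.getElem?_eq_getElem (by omega))
    exact (mono' i hs (by omega)).trans_lt (hc.trans_le (mono' r (by omega) (by omega)))
  rw [swapTails_of_ne _ hir his]
  exact hA i

/-! ### Cancellation in the determinant -/

/-- If the row lengths of an array without flaws are a permutation of `k` shifted by the row index,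
with `k` strictly decreasing, then the permutation is trivial. -/
theorem perm_eq_one_of_not_isFlaw {P : Type*} [PartialOrder P] {m : ℕ} {A : Fin m → List P}
    {k : Fin m → ℤ} (hk : StrictAnti k) {σ : Equiv.Perm (Fin m)}
    (hlen : ∀ i, ((A i).length : ℤ) = k (σ i) + i) (hA : ∀ r s c, ¬ IsFlaw A r s c) : σ = 1 := by
  have step : ∀ r s : Fin m, s.val = r.val + 1 → σ r < σ s := by
    intro r s hrs
    have hle : (A s).length ≤ (A r).length := by
      by_contra! hlt
      exact hA r s (A r).length ⟨hrs, _, List.getElem?_eq_getElem hlt, by simp⟩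
    have h1 := hlen r
    have h2 := hlen s
    -- Weakly decreasing lengths become strictly decreasing values of `k ∘ σ` once the shift by the
    -- row index is removed.
    exact hk.lt_iff_gt.1 (by omega)
  have hmono : StrictMono σ := by
    cases m with
    | zero => exact fun a => a.elim0
    | succ n => exact Fin.strictMono_iff_lt_succ.2 fun i => step _ _ (by simp)
  ext i
  exact congrArg Fin.val (congrFun (Subsingleton.elim
    (hmono.orderIsoOfSurjective σ σ.surjective) (OrderIso.refl _) |> congrArg DFunLike.coe) i)

/-- A determinant of elementary polynomials of the incomparability graph of a unit interval order
has nonnegative integral coefficients. -/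
theorem det_elemGPoly_mem_rangeS {P : Type*} [PartialOrder P] [Fintype P] {f : P → ℝ}
    (hf : ∀ u w : P, u < w ↔ f u + 1 ≤ f w) {m : ℕ} {k : Fin m → ℤ} (hk : StrictAnti k) :
    Matrix.det (Matrix.of fun i j : Fin m => elemGPoly (incGraph P) (k i + j)) ∈
      (MvPolynomial.map (σ := P) (Nat.castRingHom ℝ)).rangeS := by
  classical
  let T : Finset (Σ _ : Equiv.Perm (Fin m), Fin m → List P) :=
    Finset.univ.sigma fun σ => Fintype.piFinset fun i => chainLists P (k (σ i) + i)
  let w : (Σ _ : Equiv.Perm (Fin m), Fin m → List P) → MvPolynomial P ℝ :=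
    fun x => ((Equiv.Perm.sign x.1 : ℤ) : MvPolynomial P ℝ) * ∏ i, listMonomial (x.2 i)
  have hT : ∀ x, x ∈ T ↔ ∀ i, (x.2 i).Pairwise (· < ·) ∧
      ((x.2 i).length : ℤ) = k (x.1 i) + i := by
    simp [T, mem_chainLists]
  have hdet : Matrix.det (Matrix.of fun i j : Fin m => elemGPoly (incGraph P) (k i + j)) =
      ∑ x ∈ T, w x := by
    rw [Matrix.det_apply', Finset.sum_sigma]
    refine Finset.sum_congr rfl fun σ _ => ?_
    simp only [Matrix.of_apply, elemGPoly_incGraph, w]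
    rw [Finset.prod_univ_sum, Finset.mul_sum]
  let flawed : (Σ _ : Equiv.Perm (Fin m), Fin m → List P) → Prop :=
    fun x => ∃ r s c, IsFlaw x.2 r s c
  have hcancel : ∑ x ∈ T with flawed x, w x = 0 := by
    have hex : ∀ x ∈ T.filter flawed, ∃ p : Fin m × Fin m × ℕ,
        IsLeadingFlaw x.2 p.1 p.2.1 p.2.2 := fun x hx => by
      obtain ⟨r, s, c, h⟩ := exists_isLeadingFlaw (Finset.mem_filter.1 hx).2
      exact ⟨(r, s, c), h⟩
    choose p hp using hex
    let g : ∀ x ∈ T.filter flawed, Σ _ : Equiv.Perm (Fin m), Fin m → List P := fun x hx =>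
      ⟨x.1 * Equiv.swap (p x hx).1 (p x hx).2.1,
        swapTails x.2 (p x hx).1 (p x hx).2.1 (p x hx).2.2⟩
    have hg : ∀ x hx, IsLeadingFlaw (g x hx).2 (p x hx).1 (p x hx).2.1 (p x hx).2.2 :=
      fun x hx => (hp x hx).isLeadingFlaw_swapTails ((hT x).1 (Finset.mem_filter.1 hx).1 _).1
    have hmem : ∀ x hx, g x hx ∈ T.filter flawed := fun x hx => by
      refine Finset.mem_filter.2 ⟨(hT _).2 fun i => ⟨?_, ?_⟩, _, _, _, (hg x hx).isFlaw⟩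
      · exact (hp x hx).pairwise_swapTails hf
          (fun j => ((hT x).1 (Finset.mem_filter.1 hx).1 j).1) i
      · have hlen := fun j => ((hT x).1 (Finset.mem_filter.1 hx).1 j).2
        have hflaw := hp x hx
        have hne := hflaw.isFlaw.ne
        have hrs := hflaw.isFlaw.1
        have hs := hflaw.isFlaw.lt_length
        have hr := hflaw.le_length
        -- The offset of the cuts makes the new lengths `(A s).length - 1` and `(A r).length + 1`;
        -- as `s = r + 1`, these are the lengths prescribed by `σ * swap r s`.
        simp only [g, Equiv.Perm.mul_apply]
        generalize (p x hx).1 = r at *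
        generalize (p x hx).2.1 = s at *
        generalize (p x hx).2.2 = c at *
        have hlr := hlen r
        have hls := hlen s
        by_cases hir : i = r
        · subst hir
          rw [swapTails_left, Equiv.swap_apply_left, List.length_append, List.length_take,
            List.length_drop]
          omega
        by_cases his : i = s
        · subst his
          rw [swapTails_right _ hne, Equiv.swap_apply_right, List.length_append,
            List.length_take, List.length_drop]
          omega
        rw [swapTails_of_ne _ hir his, Equiv.swap_apply_of_ne_of_ne hir his, hlen]
    refine Finset.sum_involution g (fun x hx => ?_) (fun x hx _ => ?_) hmem (fun x hx => ?_)
    · have hprod := (hp x hx).prod_swapTails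
      simp only [w, g, hprod, Equiv.Perm.sign_mul, Equiv.Perm.sign_swap (hp x hx).isFlaw.ne.symm]
      simp
    · intro heq
      have h1 := congrArg Sigma.fst heq
      exact (hp x hx).isFlaw.ne.symm (Equiv.swap_eq_one_iff.1 (mul_eq_left.1 h1))
    -- Uniqueness of the leading flaw makes the second exchange use the same rows and column as the
    -- first.
    · obtain ⟨h1, h2, h3⟩ := (hp _ (hmem x hx)).unique (hg x hx)
      refine Sigma.ext ?_ (heq_of_eq ?_)
      · change x.1 * Equiv.swap _ _ * Equiv.swap _ _ = x.1
        rw [h1, h2, mul_assoc, Equiv.swap_mul_self, mul_one]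
      · change swapTails (swapTails x.2 _ _ _) _ _ _ = x.2
        rw [h1, h2, h3, (hp x hx).swapTails_swapTails]
  rw [hdet, ← Finset.sum_filter_add_sum_filter_not T flawed, hcancel, zero_add]
  refine Subsemiring.sum_mem _ fun x hx => ?_
  obtain ⟨hxT, hflaw⟩ := Finset.mem_filter.1 hx
  have hσ : x.1 = 1 := perm_eq_one_of_not_isFlaw hk (fun i => ((hT x).1 hxT i).2)
    fun r s c h => hflaw ⟨r, s, c, h⟩
  simp only [w, hσ, Equiv.Perm.sign_one, Units.val_one, Int.cast_one, one_mul]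
  exact Subsemiring.prod_mem _ fun i _ => listMonomial_mem_rangeS _

/-- For a unit interval order `U` with incomparability graph `G` and every partition `lam`, the
`G`-Schur polynomial lies in `ℕ[V(G)]`: it is the image of a polynomial with coefficients in `ℕ`. -/
theorem mainTheorem1 {U : Type*} [PartialOrder U] [Fintype U] (hU : IsUnitIntervalOrder U)
    (lam : YoungDiagram) :
    schurGPoly (incGraph U) lam ∈ Set.range (MvPolynomial.map (σ := U) (Nat.castRingHom ℝ)) := by
  obtain ⟨-, f, -, hf⟩ := hU
  have hk : StrictAnti fun i : Fin lam.transpose.rowLens.length =>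
      (lam.transpose.rowLen i : ℤ) - (i : ℤ) := fun i j hij => by
    have := lam.transpose.rowLen_anti i j hij.le
    have : i.val < j.val := hij
    simp only
    omega
  have h := det_elemGPoly_mem_rangeS hf hk
  simp only [sub_add_eq_add_sub] at h
  exact h
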